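/- Let $X,Y$ be finite sets and let $F\colon X\times Y\to\{-1,+1,*\}$ be a partial two-party communication problem, where $*$ stands for an undefined value; put $\operatorname{dom}F=\{(x,y): F(x,y)\ne *\}$. For $\epsilon>0$ let $Q^*_\epsilon(F)$ denote the $\epsilon$-error quantum communication complexity of $F$ with arbitrary prior entanglement, that is, the least total number of qubits sent by a two-party quantum protocol that starts from an arbitrary input-independent entangled state shared by the two players and that, for every $(x,y)\in\operatorname{dom}F$, outputs $F(x,y)$ with probability at least $1-\epsilon$ (the protocol may behave arbitrarily on inputs outside $\operatorname{dom}F$). Let $\Psi=[\Psi_{x,y}]_{x\in X,\,y\in Y}$ be any real matrix with $\|\Psi\|_1=\sum_{x,y}|\Psi_{x,y}|=1$, and let $\|\Psi\|$ be its spectral norm. Then for each $\epsilon>0$, \[ 4^{Q^*_\epsilon(F)}\;\ge\;\frac{1}{3\,\|\Psi\|\sqrt{|X|\,|Y|}}\left(\sum_{(x,y)\in\operatorname{dom}F}\Psi_{x,y}F(x,y)\;-\sum_{(x,y)\notin\operatorname{dom}F}|\Psi_{x,y}|\;-\;2\epsilon\right). \] -/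

import Mathlib

noncomputable section

namespace QuantumComm

open Matrix

/-- The communication phase and the final measurement of a two-party quantum protocol on inputs
`x : X` (Alice) and `y : Y` (Bob), when Alice currently holds a register `ℂ^m` and Bob a
register `ℂ^n`.

In a step the sender applies to the own register an isometry that depends only on the sender's
input (that is, appends an ancilla and applies a unitary), splitting the result into a part that
is kept and a `k`-qubit message `ℂ^(2^k)`; the message is then added to the receiver's register.
The order of the senders and the lengths of the messages do not depend on the input. At the end
one of the players performs a two-outcome projective measurement on the own register; the outcome
belonging to the given projection is "accept". -/
inductive Protocol (X : Type*) (Y : Type*) : ℕ → ℕ → Type _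
  | aliceOutputs {m n : ℕ} (P : X → Matrix (Fin m) (Fin m) ℂ)
      (hP : ∀ x, IsStarProjection (P x)) : Protocol X Y m n
  | bobOutputs {m n : ℕ} (P : Y → Matrix (Fin n) (Fin n) ℂ)
      (hP : ∀ y, IsStarProjection (P y)) : Protocol X Y m n
  | aliceSends {m n : ℕ} (k m' : ℕ) (V : X → Matrix (Fin m' × Fin (2 ^ k)) (Fin m) ℂ)
      (hV : ∀ x, (V x)ᴴ * V x = 1) (next : Protocol X Y m' (2 ^ k * n)) : Protocol X Y m n
  | bobSends {m n : ℕ} (k n' : ℕ) (W : Y → Matrix (Fin (2 ^ k) × Fin n') (Fin n) ℂ)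
      (hW : ∀ y, (W y)ᴴ * W y = 1) (next : Protocol X Y (m * 2 ^ k) n') : Protocol X Y m n

namespace Protocol

variable {X Y : Type*}

/-- The total number of qubits sent. -/
def cost {m n : ℕ} : Protocol X Y m n → ℕ
  | aliceOutputs _ _ => 0
  | bobOutputs _ _ => 0
  | aliceSends k _ _ _ next => k + next.cost
  | bobSends k _ _ _ next => k + next.cost

/-- The probability of acceptance on input `(x, y)` when the joint state in `ℂ^m ⊗ ℂ^n` has the
amplitudes `ψ i j`. An operator `V ⊗ 1` acts on amplitudes by `V * ψ`, and `1 ⊗ W` by `ψ * Wᵀ`. -/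
def acceptProb {m n : ℕ} :
    Protocol X Y m n → X → Y → Matrix (Fin m) (Fin n) ℂ → ℝ
  | aliceOutputs P _, x, _, ψ => ∑ i, ∑ j, ‖(P x * ψ) i j‖ ^ 2
  | bobOutputs P _, _, y, ψ => ∑ i, ∑ j, ‖(ψ * (P y)ᵀ) i j‖ ^ 2
  | aliceSends _ _ V _ next, x, y, ψ =>
      next.acceptProb x y (Matrix.of fun i j =>
        (V x * ψ) (i, (finProdFinEquiv.symm j).1) (finProdFinEquiv.symm j).2)
  | bobSends _ _ W _ next, x, y, ψ =>
      next.acceptProb x y (Matrix.of fun i j =>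
        (ψ * (W y)ᵀ) (finProdFinEquiv.symm i).1 ((finProdFinEquiv.symm i).2, j))

end Protocol

/-- A quantum protocol with arbitrary prior entanglement: the players start in an arbitrary
input-independent unit vector `ψ` of `ℂ^m ⊗ ℂ^n`, and then communicate. -/
structure EntangledProtocol (X : Type*) (Y : Type*) where
  m : ℕ
  n : ℕ
  ψ : Matrix (Fin m) (Fin n) ℂ
  unit : ∑ i, ∑ j, ‖ψ i j‖ ^ 2 = 1
  run : Protocol X Y m n

namespace EntangledProtocol

variable {X Y : Type*}

/-- The probability that the output on `(x, y)` is `s`; acceptance is the output `-1` ("true"),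
rejection the output `+1` ("false"). -/
def outputProb (P : EntangledProtocol X Y) (x : X) (y : Y) (s : ℤˣ) : ℝ :=
  if s = -1 then P.run.acceptProb x y P.ψ else 1 - P.run.acceptProb x y P.ψ

/-- `P` computes the partial function `F` with error `ε`; `none` is the undefined value, where
`P` may behave arbitrarily. -/
def Computes (P : EntangledProtocol X Y) (F : X × Y → Option ℤˣ) (ε : ℝ) : Prop :=
  ∀ x y s, F (x, y) = some s → 1 - ε ≤ P.outputProb x y s

end EntangledProtocol

/-- The `ε`-error quantum communication complexity with prior entanglement of a partial
function `F : X × Y → {-1, +1, *}`. -/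
def entangledComplexity {X Y : Type*} (ε : ℝ) (F : X × Y → Option ℤˣ) : ℕ :=
  sInf {c | ∃ P : EntangledProtocol X Y, P.Computes F ε ∧ P.run.cost = c}

/-- The infimum above is over a nonempty set: Alice can send her whole input. -/
theorem exists_computes {X Y : Type*} [Finite X] (F : X × Y → Option ℤˣ) {ε : ℝ} (hε : 0 ≤ ε) :
    ∃ P : EntangledProtocol X Y, P.Computes F ε := by
  classical
  obtain ⟨N, ⟨e⟩⟩ := Finite.exists_equiv_fin X
  have hN : N ≤ 2 ^ N := Nat.lt_two_pow_self.le
  let g : X → Fin (2 ^ N) := fun x => Fin.castLE hN (e x)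
  have hg : Function.Injective g := fun a b h => e.injective (Fin.castLE_injective hN h)
  let D : Y → Fin (2 ^ N * 1) → ℂ := fun y j =>
    if ∃ x, g x = (finProdFinEquiv.symm j).1 ∧ F (x, y) = some (-1) then 1 else 0
  let V : X → Matrix (Fin 1 × Fin (2 ^ N)) (Fin 1) ℂ :=
    fun x => Matrix.of fun p _ => if p.2 = g x then 1 else 0
  have hV : ∀ x, (V x)ᴴ * V x = 1 := by
    intro x
    ext i j
    fin_cases i; fin_cases j
    simp [V, Matrix.mul_apply, Fintype.sum_prod_type]
  have hD : ∀ y, IsStarProjection (Matrix.diagonal (D y)) := by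
    intro y
    refine ⟨?_, ?_⟩
    · rw [IsIdempotentElem, Matrix.diagonal_mul_diagonal]
      congr 1
      ext j
      simp [D]
    · rw [IsSelfAdjoint, Matrix.star_eq_conjTranspose, Matrix.diagonal_conjTranspose]
      congr 1
      ext j
      simp only [D, Pi.star_apply]
      split_ifs <;> simp
  refine ⟨⟨1, 1, 1, by simp,
    .aliceSends N 1 V hV (.bobOutputs (fun y => Matrix.diagonal (D y)) hD)⟩, ?_⟩
  intro x y s hs
  have key : Protocol.acceptProb (.aliceSends N 1 V hV
      (.bobOutputs (fun y => Matrix.diagonal (D y)) hD) : Protocol X Y 1 1)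
      x y 1 = if F (x, y) = some (-1) then 1 else 0 := by
    simp only [Protocol.acceptProb, Matrix.diagonal_transpose, Matrix.mul_diagonal,
      Matrix.mul_one, Matrix.of_apply]
    rw [Fin.sum_univ_one, ← finProdFinEquiv.sum_comp, Fintype.sum_prod_type,
      Finset.sum_eq_single (g x)]
    · simp only [Finset.univ_unique, Finset.sum_singleton, Matrix.of_apply,
        Equiv.symm_apply_apply, V, D, hg.eq_iff, exists_eq_left]
      split_ifs <;> simp
    · intro b _ hb
      simp only [V, Matrix.of_apply, Equiv.symm_apply_apply, hb]
      simp
    · simp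
  simp only [EntangledProtocol.outputProb, key, hs]
  rcases Int.units_eq_one_or s with rfl | rfl <;> simp [hε]

/-- The domain of a partial function. -/
def dom {X Y : Type*} [Fintype X] [Fintype Y] (F : X × Y → Option ℤˣ) : Finset (X × Y) :=
  Finset.univ.filter fun p => (F p).isSome

/-- The points where a partial function is undefined. -/
def offDom {X Y : Type*} [Fintype X] [Fintype Y] (F : X × Y → Option ℤˣ) : Finset (X × Y) :=
  Finset.univ.filter fun p => F p = none

/-- The real value of a partial function at a point of its domain (`0` elsewhere). -/
def value {X Y : Type*} (F : X × Y → Option ℤˣ) (p : X × Y) : ℝ :=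
  (F p).elim 0 fun s => ((s : ℤ) : ℝ)

open Classical in
/-- The spectral norm of a real matrix, i.e. the operator norm for the Euclidean norms. -/
def spectralNorm {X Y : Type*} [Fintype X] [Fintype Y] (A : Matrix X Y ℝ) : ℝ :=
  ‖(Matrix.toLpLin 2 2 A).toContinuousLinearMap‖

end QuantumComm

end

open scoped Matrix.Norms.L2Operator ComplexConjugate
open Matrix

/-! Expand the final amplitudes over all message transcripts: after `c` qubits they are a sum of `2
^ c` terms `A ψ Bᵀ`, with contractions `A` depending only on `x` and `B` only on `y`. The acceptance
probability is the squared Frobenius norm of such a sum, so it splits into `4 ^ c` inner products of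
a vector depending on `x` with one depending on `y`, each of length at most 1. By Cauchy–Schwarz
each correlates with `Ψ` by at most `‖Ψ‖ √(|X||Y|)`, whatever the dimension; hence entanglement is
free. This is `sum_mul_frobeniusSq_le`, carried through the protocol by
`Protocol.abs_sum_mul_acceptProb_le`. Conversely, the expected output of a correct protocol is
within `2ε` of `F` on its domain and in `[-1, 1]` elsewhere, so its correlation with `Ψ` is large
(`le_sum_mul_expectedOutput`). -/

namespace QuantumComm

/-! ### Contractions and the Frobenius norm. -/

section Frobenius

variable {ι κ μ : Type*} [Fintype ι] [Fintype κ] [Fintype μ]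

/-- The squared Frobenius norm of a complex matrix. -/
noncomputable def frobeniusSq (M : Matrix ι κ ℂ) : ℝ := ∑ i, ∑ j, ‖M i j‖ ^ 2

lemma frobeniusSq_nonneg (M : Matrix ι κ ℂ) : 0 ≤ frobeniusSq M :=
  Finset.sum_nonneg fun _ _ => Finset.sum_nonneg fun _ _ => sq_nonneg _

lemma frobeniusSq_transpose (M : Matrix ι κ ℂ) : frobeniusSq Mᵀ = frobeniusSq M :=
  Finset.sum_comm

/-- Holds column by column, as `‖A‖` is the Euclidean operator norm. -/
lemma frobeniusSq_mul_le [DecidableEq ι] [DecidableEq κ] (A : Matrix ι κ ℂ) (hA : ‖A‖ ≤ 1)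
    (M : Matrix κ μ ℂ) : frobeniusSq (A * M) ≤ frobeniusSq M := by
  rw [← frobeniusSq_transpose (A * M), ← frobeniusSq_transpose M]
  refine Finset.sum_le_sum fun j _ => ?_
  have h := (Matrix.l2_opNorm_mulVec A (WithLp.toLp 2 fun i => M i j)).trans
    (mul_le_of_le_one_left (norm_nonneg _) hA)
  have h' := pow_le_pow_left₀ (norm_nonneg _) h 2
  rw [EuclideanSpace.norm_sq_eq, EuclideanSpace.norm_sq_eq] at h'
  simpa [Matrix.mul_apply, Matrix.mulVec, dotProduct] using h'

lemma norm_le_one_of_conjTranspose_mul_self [DecidableEq ι] [DecidableEq κ]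
    (A : Matrix ι κ ℂ) (hA : Aᴴ * A = 1) : ‖A‖ ≤ 1 := by
  have h := Matrix.l2_opNorm_conjTranspose_mul_self A
  -- Equality fails for empty `κ`, where the norm is 0.
  have h1 : ‖(1 : Matrix κ κ ℂ)‖ ≤ 1 := by
    rw [Matrix.l2_opNorm_def]
    refine ContinuousLinearMap.opNorm_le_bound _ zero_le_one fun v => ?_
    simp
  rw [hA] at h
  nlinarith [norm_nonneg A]

lemma norm_le_one_of_isStarProjection [DecidableEq ι]
    (A : Matrix ι ι ℂ) (hA : IsStarProjection A) : ‖A‖ ≤ 1 := by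
  have h := Matrix.l2_opNorm_conjTranspose_mul_self A
  rw [← Matrix.star_eq_conjTranspose, hA.isSelfAdjoint.star_eq, hA.isIdempotentElem.eq] at h
  nlinarith [norm_nonneg A]

lemma norm_mul_le_one {ν : Type*} [Fintype ν] [DecidableEq ι] [DecidableEq κ] [DecidableEq ν]
    {A : Matrix ι κ ℂ} {B : Matrix κ ν ℂ} (hA : ‖A‖ ≤ 1) (hB : ‖B‖ ≤ 1) : ‖A * B‖ ≤ 1 :=
  (Matrix.l2_opNorm_mul A B).trans (mul_le_one₀ hA (norm_nonneg _) hB)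

lemma norm_one_submatrix_le_one [DecidableEq ι] [DecidableEq κ] {f : κ → ι}
    (hf : Function.Injective f) : ‖(1 : Matrix ι ι ℂ).submatrix id f‖ ≤ 1 := by
  apply norm_le_one_of_conjTranspose_mul_self
  rw [Matrix.conjTranspose_submatrix, Matrix.conjTranspose_one,
    ← Matrix.submatrix_mul 1 1 f id f Function.bijective_id, Matrix.mul_one,
    Matrix.submatrix_one f hf]

lemma norm_one_submatrix_le_one' [DecidableEq ι] [DecidableEq κ] {f : κ → ι}
    (hf : Function.Injective f) : ‖(1 : Matrix ι ι ℂ).submatrix f id‖ ≤ 1 := by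
  rw [← Matrix.l2_opNorm_conjTranspose, Matrix.conjTranspose_submatrix, Matrix.conjTranspose_one]
  exact norm_one_submatrix_le_one hf

/-- The real Frobenius inner product. -/
noncomputable def frobeniusInner (M N : Matrix ι κ ℂ) : ℝ := (Mᴴ * N).trace.re

lemma frobeniusInner_eq_sum (M N : Matrix ι κ ℂ) :
    frobeniusInner M N =
      ∑ p : ι × κ, ((M p.1 p.2).re * (N p.1 p.2).re + (M p.1 p.2).im * (N p.1 p.2).im) := by
  rw [frobeniusInner, Fintype.sum_prod_type, Finset.sum_comm]
  simp [Matrix.trace, Matrix.mul_apply]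

lemma frobeniusSq_eq_sum (M : Matrix ι κ ℂ) :
    frobeniusSq M = ∑ p : ι × κ, ((M p.1 p.2).re ^ 2 + (M p.1 p.2).im ^ 2) := by
  simp_rw [frobeniusSq, Fintype.sum_prod_type, ← Complex.normSq_eq_norm_sq, Complex.normSq_apply,
    sq]

lemma frobeniusSq_eq_inner (M : Matrix ι κ ℂ) : frobeniusSq M = frobeniusInner M M := by
  simp_rw [frobeniusSq_eq_sum, frobeniusInner_eq_sum, sq]

lemma frobeniusSq_sum {K : Type*} [Fintype K] (T : K → Matrix ι κ ℂ) :
    frobeniusSq (∑ k, T k) = ∑ k, ∑ l, frobeniusInner (T k) (T l) := by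
  simp_rw [frobeniusSq_eq_inner, frobeniusInner, Matrix.conjTranspose_sum, Matrix.sum_mul,
    Matrix.mul_sum, Matrix.trace_sum, Complex.re_sum]

end Frobenius

/-! ### Correlation of `Ψ` with inner products. -/

section Spectral

variable {X Y : Type*} [Fintype X] [Fintype Y]

lemma spectralNorm_nonneg (Ψ : Matrix X Y ℝ) : 0 ≤ spectralNorm Ψ := norm_nonneg _

lemma sum_mul_mul_le_spectralNorm (Ψ : Matrix X Y ℝ) (f : X → ℝ) (g : Y → ℝ) :
    |∑ x, ∑ y, Ψ x y * (f x * g y)| ≤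
      spectralNorm Ψ * (√(∑ x, f x ^ 2) * √(∑ y, g y ^ 2)) := by
  classical
  have h1 := abs_real_inner_le_norm (WithLp.toLp 2 f : EuclideanSpace ℝ X)
    ((Matrix.toLpLin 2 2 Ψ).toContinuousLinearMap (WithLp.toLp 2 g : EuclideanSpace ℝ Y))
  have h2 := (Matrix.toLpLin 2 2 Ψ).toContinuousLinearMap.le_opNorm
    (WithLp.toLp 2 g : EuclideanSpace ℝ Y)
  have h3 : spectralNorm Ψ = ‖(Matrix.toLpLin 2 2 Ψ).toContinuousLinearMap‖ := by
    unfold spectralNorm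
    congr!
  rw [← h3] at h2
  have h4 : (∑ x, ∑ y, Ψ x y * (f x * g y)) = inner ℝ (WithLp.toLp 2 f : EuclideanSpace ℝ X)
      ((Matrix.toLpLin 2 2 Ψ).toContinuousLinearMap (WithLp.toLp 2 g : EuclideanSpace ℝ Y)) := by
    simp only [PiLp.inner_apply, LinearMap.coe_toContinuousLinearMap', Matrix.toLpLin_apply,
      Matrix.mulVec, dotProduct, RCLike.inner_apply, conj_trivial, Finset.sum_mul]
    exact Finset.sum_congr rfl fun x _ => Finset.sum_congr rfl fun y _ => by ring
  have h5 : ‖(WithLp.toLp 2 f : EuclideanSpace ℝ X)‖ = √(∑ x, f x ^ 2) := by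
    simp [EuclideanSpace.norm_eq]
  have h6 : ‖(WithLp.toLp 2 g : EuclideanSpace ℝ Y)‖ = √(∑ x, g x ^ 2) := by
    simp [EuclideanSpace.norm_eq]
  rw [h4]
  rw [h5] at h1
  rw [h6] at h2
  calc _ ≤ _ := h1
    _ ≤ √(∑ x, f x ^ 2) * (spectralNorm Ψ * √(∑ x, g x ^ 2)) := by gcongr
    _ = _ := by ring

/-- Apply the bilinear bound to each coordinate `i`, then Cauchy–Schwarz over `i`: the total squared
lengths of the two families are at most `|X|` and `|Y|`. -/
lemma sum_mul_sum_mul_le_spectralNorm {ι : Type*} [Fintype ι] (Ψ : Matrix X Y ℝ)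
    (f : X → ι → ℝ) (g : Y → ι → ℝ) (hf : ∀ x, ∑ i, f x i ^ 2 ≤ 1)
    (hg : ∀ y, ∑ i, g y i ^ 2 ≤ 1) :
    |∑ x, ∑ y, Ψ x y * ∑ i, f x i * g y i| ≤
      spectralNorm Ψ * √((Fintype.card X : ℝ) * (Fintype.card Y : ℝ)) := by
  have h1 : (∑ x, ∑ y, Ψ x y * ∑ i, f x i * g y i)
      = ∑ i, ∑ x, ∑ y, Ψ x y * (f x i * g y i) := by
    simp_rw [Finset.mul_sum]
    rw [Finset.sum_comm' (t' := Finset.univ) (s' := fun _ => Finset.univ) (by simp)]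
    rw [Finset.sum_comm]
    conv_rhs => rw [Finset.sum_comm]
    refine Finset.sum_congr rfl fun x _ => ?_
    rw [Finset.sum_comm]
  have h2 : ∑ i, ∑ x, f x i ^ 2 ≤ Fintype.card X := by
    rw [Finset.sum_comm]
    exact (Finset.sum_le_sum fun x _ => hf x).trans (by simp)
  have h3 : ∑ i, ∑ y, g y i ^ 2 ≤ Fintype.card Y := by
    rw [Finset.sum_comm]
    exact (Finset.sum_le_sum fun x _ => hg x).trans (by simp)
  rw [h1]
  calc _ ≤ ∑ i, |∑ x, ∑ y, Ψ x y * (f x i * g y i)| := Finset.abs_sum_le_sum_abs _ _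
    _ ≤ ∑ i, spectralNorm Ψ * (√(∑ x, f x i ^ 2) * √(∑ y, g y i ^ 2)) :=
      Finset.sum_le_sum fun i _ => sum_mul_mul_le_spectralNorm Ψ _ _
    _ = spectralNorm Ψ * ∑ i, √(∑ x, f x i ^ 2) * √(∑ y, g y i ^ 2) := by
      rw [Finset.mul_sum]
    _ ≤ spectralNorm Ψ * (√(∑ i, ∑ x, f x i ^ 2) * √(∑ i, ∑ y, g y i ^ 2)) := by
      gcongr
      · exact spectralNorm_nonneg Ψ
      · exact Real.sum_sqrt_mul_sqrt_le _ (fun _ => by positivity) (fun _ => by positivity)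
    _ ≤ _ := by
      rw [Real.sqrt_mul (by positivity)]
      gcongr
      exact spectralNorm_nonneg Ψ

lemma sum_mul_frobeniusInner_le_spectralNorm {ι κ : Type*} [Fintype ι] [Fintype κ]
    (Ψ : Matrix X Y ℝ) (U : X → Matrix ι κ ℂ) (V : Y → Matrix ι κ ℂ)
    (hU : ∀ x, frobeniusSq (U x) ≤ 1) (hV : ∀ y, frobeniusSq (V y) ≤ 1) :
    |∑ x, ∑ y, Ψ x y * frobeniusInner (U x) (V y)| ≤
      spectralNorm Ψ * √((Fintype.card X : ℝ) * (Fintype.card Y : ℝ)) := by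
  have h := sum_mul_sum_mul_le_spectralNorm Ψ
    (fun x => Sum.elim (fun p : ι × κ => (U x p.1 p.2).re) fun p : ι × κ => (U x p.1 p.2).im)
    (fun y => Sum.elim (fun p : ι × κ => (V y p.1 p.2).re) fun p : ι × κ => (V y p.1 p.2).im)
    (fun x => by simpa [frobeniusSq_eq_sum, Finset.sum_add_distrib] using hU x)
    (fun y => by simpa [frobeniusSq_eq_sum, Finset.sum_add_distrib] using hV y)
  simpa only [frobeniusInner_eq_sum, Fintype.sum_sum_type, Sum.elim_inl, Sum.elim_inr,
    Finset.sum_add_distrib] using h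

/-- If the amplitudes are a sum of `|K|` terms `A ψ Bᵀ`, with contractions `A` depending on `x`
and `B` depending on `y`, then the squared norms correlate weakly with `Ψ`. -/
lemma sum_mul_frobeniusSq_le {m n m₀ n₀ : ℕ} {K : Type*} [Fintype K] (Ψ : Matrix X Y ℝ)
    (ψ : Matrix (Fin m₀) (Fin n₀) ℂ) (hψ : frobeniusSq ψ ≤ 1)
    (A : K → X → Matrix (Fin m) (Fin m₀) ℂ) (B : K → Y → Matrix (Fin n) (Fin n₀) ℂ)
    (hA : ∀ k x, ‖A k x‖ ≤ 1) (hB : ∀ k y, ‖B k y‖ ≤ 1) :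
    |∑ x, ∑ y, Ψ x y * frobeniusSq (∑ k, A k x * ψ * (B k y)ᵀ)| ≤
      (Fintype.card K : ℝ) ^ 2 *
        (spectralNorm Ψ * √((Fintype.card X : ℝ) * (Fintype.card Y : ℝ))) := by
  have hA' : ∀ k x, ‖(A k x)ᴴ‖ ≤ 1 := fun k x => by
    rw [Matrix.l2_opNorm_conjTranspose]; exact hA k x
  have hB' : ∀ k y, ‖(B k y)ᴴ‖ ≤ 1 := fun k y => by
    rw [Matrix.l2_opNorm_conjTranspose]; exact hB k y
  -- Cyclicity of the trace gathers the factors in `x` on one side of each cross term and those in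
  -- `y` on the other; both sides keep a copy of `ψ`, which bounds their lengths.
  have h1 : ∀ x y, frobeniusSq (∑ k, A k x * ψ * (B k y)ᵀ) = ∑ p : K × K,
      frobeniusInner ((A p.2 x)ᴴ * (A p.1 x * ψ)) (((B p.1 y)ᴴ * (B p.2 y * ψᵀ))ᵀ) := by
    intro x y
    rw [frobeniusSq_sum, Fintype.sum_prod_type]
    refine Finset.sum_congr rfl fun k _ => Finset.sum_congr rfl fun l _ => ?_
    simp only [frobeniusInner, Matrix.conjTranspose_mul, Matrix.transpose_mul,
      Matrix.conjTranspose_conjTranspose, Matrix.transpose_transpose, Matrix.mul_assoc]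
    rw [Matrix.trace_mul_comm]
    simp only [Matrix.mul_assoc]
    rfl
  have h2 : (∑ x, ∑ y, Ψ x y * frobeniusSq (∑ k, A k x * ψ * (B k y)ᵀ)) =
      ∑ p : K × K, ∑ x, ∑ y, Ψ x y *
        frobeniusInner ((A p.2 x)ᴴ * (A p.1 x * ψ)) (((B p.1 y)ᴴ * (B p.2 y * ψᵀ))ᵀ) := by
    simp_rw [h1, Finset.mul_sum]
    conv_rhs => rw [Finset.sum_comm]
    refine Finset.sum_congr rfl fun x _ => ?_
    rw [Finset.sum_comm]
  rw [h2]
  refine (Finset.abs_sum_le_sum_abs _ _).trans ?_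
  refine (Finset.sum_le_sum fun p _ => sum_mul_frobeniusInner_le_spectralNorm Ψ _ _
    (fun x => ?_) (fun y => ?_)).trans ?_
  · exact (frobeniusSq_mul_le _ (hA' _ _) _).trans ((frobeniusSq_mul_le _ (hA _ _) _).trans hψ)
  · rw [frobeniusSq_transpose]
    refine (frobeniusSq_mul_le _ (hB' _ _) _).trans ((frobeniusSq_mul_le _ (hB _ _) _).trans ?_)
    rwa [frobeniusSq_transpose]
  · simp [sq]

end Spectral

/-! ### Effect of one message on the expansion. -/

section Message

lemma one_submatrix_id_mul {ι κ μ : Type*} [Fintype ι] [DecidableEq ι] (f : κ → ι)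
    (M : Matrix ι μ ℂ) : (1 : Matrix ι ι ℂ).submatrix f id * M = M.submatrix f id :=
  Matrix.one_submatrix_mul f (Equiv.refl ι) M

/-- Moving `a` from the left register to the right one, in terms of the summands `A ψ Bᵀ`. -/
lemma sum_alice_message {m n m₀ n₀ m' d : ℕ} {K : Type*} [Fintype K]
    (V : Matrix (Fin m' × Fin d) (Fin m) ℂ) (ψ : Matrix (Fin m₀) (Fin n₀) ℂ)
    (A : K → Matrix (Fin m) (Fin m₀) ℂ) (B : K → Matrix (Fin n) (Fin n₀) ℂ) :
    (Matrix.of fun i j => (V * ∑ k, A k * ψ * (B k)ᵀ)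
        (i, (finProdFinEquiv.symm j).1) (finProdFinEquiv.symm j).2) =
      ∑ q : K × Fin d,
        (1 : Matrix (Fin m' × Fin d) (Fin m' × Fin d) ℂ).submatrix (fun i => (i, q.2)) id *
          (V * A q.1) * ψ *
        ((1 : Matrix (Fin (d * n)) (Fin (d * n)) ℂ).submatrix id
          (fun j => finProdFinEquiv (q.2, j)) * B q.1)ᵀ := by
  ext i j
  obtain ⟨⟨a, b⟩, rfl⟩ := finProdFinEquiv.surjective j
  rw [Matrix.of_apply, Equiv.symm_apply_apply, Matrix.mul_sum, Matrix.sum_apply,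
    Matrix.sum_apply, Fintype.sum_prod_type]
  refine Finset.sum_congr rfl fun k _ => ?_
  -- Row `(a, b)` of the embedding at message value `c` vanishes unless `c = a`.
  rw [Finset.sum_eq_single a]
  · have h1 : (1 : Matrix (Fin m' × Fin d) (Fin m' × Fin d) ℂ).submatrix (fun i => (i, a)) id *
        (V * A k) * ψ = (V * A k * ψ).submatrix (fun i => (i, a)) id := by
      rw [one_submatrix_id_mul]
      rfl
    rw [h1, ← Matrix.mul_assoc, ← Matrix.mul_assoc, Matrix.mul_apply, Matrix.mul_apply]
    refine Finset.sum_congr rfl fun l _ => ?_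
    congr 1
    simp [Matrix.mul_apply, Matrix.one_apply]
  · intro c _ hc
    rw [Matrix.mul_apply]
    refine Finset.sum_eq_zero fun l _ => ?_
    simp [Matrix.mul_apply, Matrix.one_apply, hc.symm]
  · simp

/-- Moving `a` from the right register to the left one, in terms of the summands `A ψ Bᵀ`. -/
lemma sum_bob_message {m n m₀ n₀ n' d : ℕ} {K : Type*} [Fintype K]
    (W : Matrix (Fin d × Fin n') (Fin n) ℂ) (ψ : Matrix (Fin m₀) (Fin n₀) ℂ)
    (A : K → Matrix (Fin m) (Fin m₀) ℂ) (B : K → Matrix (Fin n) (Fin n₀) ℂ) :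
    (Matrix.of fun i j => ((∑ k, A k * ψ * (B k)ᵀ) * Wᵀ)
        (finProdFinEquiv.symm i).1 ((finProdFinEquiv.symm i).2, j)) =
      ∑ q : K × Fin d,
        (1 : Matrix (Fin (m * d)) (Fin (m * d)) ℂ).submatrix id
          (fun i => finProdFinEquiv (i, q.2)) * A q.1 * ψ *
        ((1 : Matrix (Fin d × Fin n') (Fin d × Fin n') ℂ).submatrix (fun j => (q.2, j)) id *
          (W * B q.1))ᵀ := by
  ext i j
  obtain ⟨⟨b, a⟩, rfl⟩ := finProdFinEquiv.surjective i
  rw [Matrix.of_apply, Equiv.symm_apply_apply, Matrix.sum_mul, Matrix.sum_apply,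
    Matrix.sum_apply, Fintype.sum_prod_type]
  refine Finset.sum_congr rfl fun k _ => ?_
  rw [Finset.sum_eq_single a]
  · have h : ∀ l, ((1 : Matrix (Fin (m * d)) (Fin (m * d)) ℂ).submatrix id
        (fun i => finProdFinEquiv (i, a)) * A k) (finProdFinEquiv (b, a)) l = A k b l := by
      intro l
      simp [Matrix.mul_apply, Matrix.one_apply]
    rw [one_submatrix_id_mul, Matrix.transpose_submatrix, Matrix.transpose_mul, Matrix.mul_assoc,
      Matrix.mul_assoc, Matrix.mul_assoc, Matrix.mul_apply, Matrix.mul_apply]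
    exact Finset.sum_congr rfl fun l _ => by rw [h]; rfl
  · intro c _ hc
    rw [Matrix.mul_assoc, Matrix.mul_apply]
    refine Finset.sum_eq_zero fun l _ => ?_
    rw [Matrix.mul_apply]
    simp [hc.symm]
  · simp

end Message

/-! ### Induction along the protocol. -/

namespace Protocol

variable {X Y : Type*}

lemma acceptProb_nonneg {m n : ℕ} (p : Protocol X Y m n) (x : X) (y : Y)
    (ψ : Matrix (Fin m) (Fin n) ℂ) : 0 ≤ p.acceptProb x y ψ := by
  induction p with
  | aliceOutputs P hP => exact frobeniusSq_nonneg (P x * ψ)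
  | bobOutputs P hP => exact frobeniusSq_nonneg (ψ * (P y)ᵀ)
  | aliceSends k m' V hV next ih => exact ih _
  | bobSends k n' W hW next ih => exact ih _

/-- Local operations are contractions, and passing a message only reindexes the amplitudes. -/
lemma acceptProb_le_frobeniusSq {m n : ℕ} (p : Protocol X Y m n) (x : X) (y : Y)
    (ψ : Matrix (Fin m) (Fin n) ℂ) : p.acceptProb x y ψ ≤ frobeniusSq ψ := by
  induction p with
  | aliceOutputs P hP =>
    exact frobeniusSq_mul_le _ (norm_le_one_of_isStarProjection _ (hP x)) ψ
  | bobOutputs P hP =>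
    refine le_trans (b := frobeniusSq (ψ * (P y)ᵀ)) le_rfl ?_
    rw [← frobeniusSq_transpose, ← frobeniusSq_transpose ψ, Matrix.transpose_mul,
      Matrix.transpose_transpose]
    exact frobeniusSq_mul_le _ (norm_le_one_of_isStarProjection _ (hP y)) _
  | aliceSends k m' V hV next ih =>
    refine (ih _).trans (le_of_eq_of_le ?_
      (frobeniusSq_mul_le _ (norm_le_one_of_conjTranspose_mul_self _ (hV x)) ψ))
    simp only [frobeniusSq, Fintype.sum_prod_type, ← finProdFinEquiv.sum_comp, Matrix.of_apply,
      Equiv.symm_apply_apply]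
  | bobSends k n' W hW next ih =>
    refine (ih _).trans ?_
    rw [← frobeniusSq_transpose ψ]
    refine le_of_eq_of_le ?_
      (frobeniusSq_mul_le _ (norm_le_one_of_conjTranspose_mul_self _ (hW y)) ψᵀ)
    rw [← frobeniusSq_transpose (W y * ψᵀ), Matrix.transpose_mul, Matrix.transpose_transpose]
    simp only [frobeniusSq, Fintype.sum_prod_type, ← finProdFinEquiv.sum_comp, Matrix.of_apply,
      Equiv.symm_apply_apply]

/-- An arbitrary starting family makes the induction work: a `k`-qubit message replaces `K` by `K ×
Fin (2 ^ k)` and lowers the remaining cost by `k`, so `|K| * 2 ^ cost` is invariant. -/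
lemma abs_sum_mul_acceptProb_le [Fintype X] [Fintype Y] {m n m₀ n₀ : ℕ} (p : Protocol X Y m n)
    {K : Type} [Fintype K] (Ψ : Matrix X Y ℝ)
    (ψ : Matrix (Fin m₀) (Fin n₀) ℂ) (hψ : frobeniusSq ψ ≤ 1)
    (A : K → X → Matrix (Fin m) (Fin m₀) ℂ) (B : K → Y → Matrix (Fin n) (Fin n₀) ℂ)
    (hA : ∀ k x, ‖A k x‖ ≤ 1) (hB : ∀ k y, ‖B k y‖ ≤ 1) :
    |∑ x, ∑ y, Ψ x y * p.acceptProb x y (∑ k, A k x * ψ * (B k y)ᵀ)| ≤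
      ((Fintype.card K : ℝ) * 2 ^ p.cost) ^ 2 *
        (spectralNorm Ψ * √((Fintype.card X : ℝ) * (Fintype.card Y : ℝ))) := by
  induction p generalizing K with
  | aliceOutputs P hP =>
    -- The final projection is absorbed into the contractions of the measuring player.
    have h := sum_mul_frobeniusSq_le Ψ ψ hψ (fun k x => P x * A k x) B
      (fun k x => norm_mul_le_one (norm_le_one_of_isStarProjection _ (hP x)) (hA k x)) hB
    simp only [Matrix.mul_assoc, ← Matrix.mul_sum] at h
    simpa only [cost, pow_zero, mul_one, Matrix.mul_assoc, acceptProb, frobeniusSq] using h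
  | bobOutputs P hP =>
    have h := sum_mul_frobeniusSq_le Ψ ψ hψ A (fun k y => P y * B k y) hA
      (fun k y => norm_mul_le_one (norm_le_one_of_isStarProjection _ (hP y)) (hB k y))
    simp only [Matrix.transpose_mul, ← Matrix.mul_assoc, ← Matrix.sum_mul] at h
    simpa only [cost, pow_zero, mul_one, acceptProb, frobeniusSq] using h
  | @aliceSends m n k m' V hV next ih =>
    have h := ih (K := K × Fin (2 ^ k))
      (fun q x => (1 : Matrix (Fin m' × Fin (2 ^ k)) _ ℂ).submatrix (fun i => (i, q.2)) id *
        (V x * A q.1 x))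
      (fun q y => (1 : Matrix (Fin (2 ^ k * n)) _ ℂ).submatrix id
        (fun j => finProdFinEquiv (q.2, j)) * B q.1 y)
      (fun q x => norm_mul_le_one
        (norm_one_submatrix_le_one' fun a b hab => congrArg Prod.fst hab)
        (norm_mul_le_one (norm_le_one_of_conjTranspose_mul_self _ (hV x)) (hA _ _)))
      (fun q y => norm_mul_le_one
        (norm_one_submatrix_le_one fun a b hab =>
          congrArg Prod.snd (finProdFinEquiv.injective hab)) (hB _ _))
    have hcard : (Fintype.card (K × Fin (2 ^ k)) : ℝ) * 2 ^ next.cost =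
        Fintype.card K * 2 ^ (aliceSends k m' V hV next).cost := by
      simp [cost, pow_add, mul_assoc]
    rw [hcard] at h
    simpa only [acceptProb, sum_alice_message] using h
  | @bobSends m n k n' W hW next ih =>
    have h := ih (K := K × Fin (2 ^ k))
      (fun q x => (1 : Matrix (Fin (m * 2 ^ k)) _ ℂ).submatrix id
        (fun i => finProdFinEquiv (i, q.2)) * A q.1 x)
      (fun q y => (1 : Matrix (Fin (2 ^ k) × Fin n') _ ℂ).submatrix (fun j => (q.2, j)) id *
        (W y * B q.1 y))
      (fun q y => norm_mul_le_one
        (norm_one_submatrix_le_one fun a b hab =>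
          congrArg Prod.fst (finProdFinEquiv.injective hab)) (hA _ _))
      (fun q x => norm_mul_le_one
        (norm_one_submatrix_le_one' fun a b hab => congrArg Prod.snd hab)
        (norm_mul_le_one (norm_le_one_of_conjTranspose_mul_self _ (hW x)) (hB _ _)))
    have hcard : (Fintype.card (K × Fin (2 ^ k)) : ℝ) * 2 ^ next.cost =
        Fintype.card K * 2 ^ (bobSends k n' W hW next).cost := by
      simp [cost, pow_add, mul_assoc]
    rw [hcard] at h
    simpa only [acceptProb, sum_bob_message] using h

end Protocol

/-! ### Upper and lower bounds on the correlation of the output with `Ψ`. -/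

namespace EntangledProtocol

variable {X Y : Type*}

lemma acceptProb_mem_Icc (P : EntangledProtocol X Y) (x : X) (y : Y) :
    P.run.acceptProb x y P.ψ ∈ Set.Icc (0 : ℝ) 1 :=
  ⟨P.run.acceptProb_nonneg x y P.ψ, (P.run.acceptProb_le_frobeniusSq x y P.ψ).trans_eq P.unit⟩

variable [Fintype X] [Fintype Y]

lemma abs_sum_mul_acceptProb_le (P : EntangledProtocol X Y) (Ψ : Matrix X Y ℝ) :
    |∑ x, ∑ y, Ψ x y * P.run.acceptProb x y P.ψ| ≤
      4 ^ P.run.cost * (spectralNorm Ψ * √((Fintype.card X : ℝ) * (Fintype.card Y : ℝ))) := by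
  have h1 {n : ℕ} : ‖(1 : Matrix (Fin n) (Fin n) ℂ)‖ ≤ 1 :=
    norm_le_one_of_conjTranspose_mul_self _ (by simp)
  have h := P.run.abs_sum_mul_acceptProb_le (K := Unit) Ψ P.ψ P.unit.le (fun _ _ => 1)
    (fun _ _ => 1) (fun _ _ => h1) (fun _ _ => h1)
  have h4 : ((2 : ℝ) ^ P.run.cost) ^ 2 = 4 ^ P.run.cost := by
    rw [← pow_mul, mul_comm, pow_mul]; norm_num
  simpa [h4] using h

/-- The expected output `1 - 2 * acceptProb` correlates weakly with `Ψ`. -/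
lemma sum_mul_expectedOutput_le (P : EntangledProtocol X Y) (Ψ : Matrix X Y ℝ) :
    ∑ x, ∑ y, Ψ x y * (1 - 2 * P.run.acceptProb x y P.ψ) ≤
      4 ^ P.run.cost *
        (3 * spectralNorm Ψ * √((Fintype.card X : ℝ) * (Fintype.card Y : ℝ))) := by
  have h1 := sum_mul_mul_le_spectralNorm Ψ (fun _ => 1) (fun _ => 1)
  simp only [mul_one, one_pow, Finset.sum_const, Finset.card_univ, nsmul_eq_mul] at h1
  rw [← Real.sqrt_mul (Nat.cast_nonneg _)] at h1
  have h2 := P.abs_sum_mul_acceptProb_le Ψ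
  have h3 : ∑ x, ∑ y, Ψ x y * (1 - 2 * P.run.acceptProb x y P.ψ) =
      (∑ x, ∑ y, Ψ x y) - 2 * ∑ x, ∑ y, Ψ x y * P.run.acceptProb x y P.ψ := by
    simp_rw [Finset.mul_sum, ← Finset.sum_sub_distrib]
    exact Finset.sum_congr rfl fun x _ => Finset.sum_congr rfl fun y _ => by ring
  -- Source of the factor 3: the constant term contributes 1, the acceptance term `2 * 4 ^ cost`,
  -- and `1 + 2 * 4 ^ cost ≤ 3 * 4 ^ cost`.
  have h4 : (1 : ℝ) ≤ 4 ^ P.run.cost := one_le_pow₀ (by norm_num)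
  have h5 : 0 ≤ spectralNorm Ψ * √((Fintype.card X : ℝ) * (Fintype.card Y : ℝ)) :=
    mul_nonneg (spectralNorm_nonneg Ψ) (Real.sqrt_nonneg _)
  rw [h3]
  nlinarith [abs_le.mp h1, abs_le.mp h2, mul_le_mul_of_nonneg_right h4 h5]

lemma le_sum_mul_expectedOutput (P : EntangledProtocol X Y) {F : X × Y → Option ℤˣ} {ε : ℝ}
    (hP : P.Computes F ε) (hε : 0 ≤ ε) (Ψ : Matrix X Y ℝ) (hΨ : ∑ x, ∑ y, |Ψ x y| = 1) :
    ∑ p ∈ dom F, Ψ p.1 p.2 * value F p - ∑ p ∈ offDom F, |Ψ p.1 p.2| - 2 * ε ≤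
      ∑ x, ∑ y, Ψ x y * (1 - 2 * P.run.acceptProb x y P.ψ) := by
  -- Spreading `2ε` over the points with weights `|Ψ|` makes the inequality pointwise.
  have h1 : 2 * ε = ∑ p : X × Y, 2 * ε * |Ψ p.1 p.2| := by
    rw [← Finset.mul_sum, Fintype.sum_prod_type, hΨ, mul_one]
  rw [h1, dom, offDom, Finset.sum_filter, Finset.sum_filter, ← Finset.sum_sub_distrib,
    ← Finset.sum_sub_distrib, ← Fintype.sum_prod_type'
      (f := fun x y => Ψ x y * (1 - 2 * P.run.acceptProb x y P.ψ))]
  refine Finset.sum_le_sum fun p _ => ?_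
  obtain ⟨x, y⟩ := p
  obtain ⟨h0, h2⟩ := P.acceptProb_mem_Icc x y
  have hc := hP x y
  rcases hF : F (x, y) with _ | s
  · have h3 : |Ψ x y * (1 - 2 * P.run.acceptProb x y P.ψ)| ≤ |Ψ x y| := by
      rw [abs_mul]
      exact mul_le_of_le_one_right (abs_nonneg _) (abs_le.mpr ⟨by linarith, by linarith⟩)
    have h4 : 0 ≤ 2 * ε * |Ψ x y| := by positivity
    simp only [Option.isSome_none, Bool.false_eq_true, if_false, if_true]
    linarith [neg_le_of_abs_le h3]
  · have hv : |Ψ x y * (((s : ℤ) : ℝ) - (1 - 2 * P.run.acceptProb x y P.ψ))| ≤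
        2 * ε * |Ψ x y| := by
      rw [abs_mul, mul_comm]
      refine mul_le_mul_of_nonneg_right ?_ (abs_nonneg _)
      have hs := hc s hF
      rcases Int.units_eq_one_or s with rfl | rfl
      · have hne : (1 : ℤˣ) ≠ -1 := by decide
        simp only [outputProb, hne, if_false] at hs
        rw [abs_le]
        push_cast
        constructor <;> linarith
      · simp only [outputProb, if_true] at hs
        rw [abs_le]
        push_cast
        constructor <;> linarith
    simp only [Option.isSome_some, if_true, reduceCtorEq, if_false, value, hF, Option.elim_some]
    linarith [le_of_abs_le hv]

end EntangledProtocol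

lemma exists_computes_cost_eq {X Y : Type*} [Finite X] (F : X × Y → Option ℤˣ) {ε : ℝ}
    (hε : 0 ≤ ε) : ∃ P : EntangledProtocol X Y,
      P.Computes F ε ∧ P.run.cost = entangledComplexity ε F := by
  obtain ⟨P, hP⟩ := exists_computes F hε
  exact Nat.sInf_mem (s := {c | ∃ P : EntangledProtocol X Y, P.Computes F ε ∧ P.run.cost = c})
    ⟨_, P, hP, rfl⟩

end QuantumComm

theorem theorem8 {X Y : Type*} [Fintype X] [Fintype Y] (F : X × Y → Option ℤˣ)
    (Ψ : Matrix X Y ℝ) (hΨ : ∑ x, ∑ y, |Ψ x y| = 1) (ε : ℝ) (hε : 0 < ε) :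
    (4 : ℝ) ^ QuantumComm.entangledComplexity ε F ≥
      1 / (3 * QuantumComm.spectralNorm Ψ * √((Fintype.card X : ℝ) * (Fintype.card Y : ℝ))) *
        (∑ p ∈ QuantumComm.dom F, Ψ p.1 p.2 * QuantumComm.value F p
          - ∑ p ∈ QuantumComm.offDom F, |Ψ p.1 p.2| - 2 * ε) := by
  obtain ⟨P, hP, hcost⟩ := QuantumComm.exists_computes_cost_eq F hε.le
  have h := (P.le_sum_mul_expectedOutput hP hε.le Ψ hΨ).trans (P.sum_mul_expectedOutput_le Ψ)
  rw [hcost] at h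
  rw [ge_iff_le, one_div_mul_eq_div]
  have hs := QuantumComm.spectralNorm_nonneg Ψ
  -- A nonnegative denominator suffices, so `‖Ψ‖ ≠ 0` is not needed.
  exact div_le_of_le_mul₀ (by positivity) (by positivity) h
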